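/- Theorem. An increasing subsequence of a permutation $p=p_1p_2\cdots p_n$ of $\{1,\dots,n\}$ is a set of entries $p_{j_1}<p_{j_2}<\cdots<p_{j_k}$ with $j_1<j_2<\cdots<j_k$ (the positions need not be consecutive). The permutation $p$ has a unique longest increasing subsequence if it has an increasing subsequence that is longer than all its other increasing subsequences. The permutation $p$ avoids $321$ if there are no indices $i_1<i_2<i_3$ with $p_{i_1}>p_{i_2}>p_{i_3}$. Let $u_n(321)$ be the number of permutations of length $n$ that avoid $321$ and have a unique longest increasing subsequence. Then \[ \lim_{n\to\infty}\bigl(u_n(321)\bigr)^{1/n}=4 . \] -/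

import Mathlib

/-- The permutation `p` of length `n` contains the pattern `q` of length `k`: there are positions
`f 0 < ⋯ < f (k - 1)` at which the entries of `p` are in the same relative order as those of `q`. -/
def ContainsPattern {n k : ℕ} (p : Equiv.Perm (Fin n)) (q : Equiv.Perm (Fin k)) : Prop :=
  ∃ f : Fin k → Fin n, StrictMono f ∧ ∀ r s : Fin k, p (f r) < p (f s) ↔ q r < q s

/-- The permutation `p` avoids the pattern `q`. -/
def AvoidsPattern {n k : ℕ} (p : Equiv.Perm (Fin n)) (q : Equiv.Perm (Fin k)) : Prop :=
  ¬ ContainsPattern p q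

/-- The entries of `p` in the (not necessarily consecutive) positions `s` form an increasing
subsequence of `p`. -/
def IsIncreasingSubseq {n : ℕ} (p : Equiv.Perm (Fin n)) (s : Finset (Fin n)) : Prop :=
  StrictMonoOn p (s : Set (Fin n))

/-- The permutation `p` has a unique longest increasing subsequence: it has an increasing
subsequence that is longer than all other increasing subsequences. -/
def HasULIS {n : ℕ} (p : Equiv.Perm (Fin n)) : Prop :=
  ∃ s : Finset (Fin n), IsIncreasingSubseq p s ∧
    ∀ t : Finset (Fin n), IsIncreasingSubseq p t → t ≠ s → t.card < s.card

/-- The number of permutations of length `n` that avoid the pattern `q` and have a unique longest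
increasing subsequence. -/
noncomputable def ulisCount {k : ℕ} (q : Equiv.Perm (Fin k)) (n : ℕ) : ℕ :=
  Nat.card {p : Equiv.Perm (Fin n) // AvoidsPattern p q ∧ HasULIS p}

/-- The pattern 321, that is, the order-reversing permutation of three letters. -/
def pattern321 : Equiv.Perm (Fin 3) := Fin.revPerm

/-! Upper bound: a 321-avoider splits into two increasing sequences, and the positions and values of
one of them determine it, so there are at most `4 ^ n`. Lower bound: merge two increasing sequences,
one with position set `P` and value set `V`. If `P` runs far enough ahead of its complement in
position while `V` gains little in value, each entry off `P` is inverted with two consecutive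
entries of `P`. Replacing entries of `P` by others then always loses (`card_lt_of_conflicts`), so
`P` is the unique longest increasing subsequence. To get many such pairs, use blocks of length `2m`
holding `m` chosen elements each, and pad `P` in front and `V` at the end by `s` elements. This
yields `centralBinom m ^ (2K)` permutations of length `s + 2mK`. Let `n → ∞` with `m` fixed, then
take `m` large. -/

open Finset Filter Topology

/-! ### Ranks, and merging two increasing sequences -/

/-- The number of elements of `S` that are smaller than `x`. -/
def rankIn {n : ℕ} (S : Finset (Fin n)) (x : Fin n) : ℕ :=
  (S.filter (· < x)).card

theorem rankIn_mono {n : ℕ} (S : Finset (Fin n)) : Monotone (rankIn S) := by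
  intro x y hxy
  refine card_le_card fun z hz => ?_
  simp only [mem_filter] at hz ⊢
  exact ⟨hz.1, hz.2.trans_le hxy⟩

theorem rankIn_lt_rankIn {n : ℕ} {S : Finset (Fin n)} {x y : Fin n} (hx : x ∈ S) (hxy : x < y) :
    rankIn S x < rankIn S y := by
  refine card_lt_card ((Finset.ssubset_iff_of_subset fun z hz => ?_).2 ⟨x, ?_, ?_⟩)
  · simp only [mem_filter] at hz ⊢
    exact ⟨hz.1, hz.2.trans hxy⟩
  · simp [hx, hxy]
  · simp

theorem rankIn_injOn {n : ℕ} (S : Finset (Fin n)) : Set.InjOn (rankIn S) S := by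
  intro x hx y hy h
  rcases lt_trichotomy x y with hlt | heq | hlt
  · exact absurd h (rankIn_lt_rankIn hx hlt).ne
  · exact heq
  · exact absurd h (rankIn_lt_rankIn hy hlt).ne'

theorem rankIn_lt_card {n : ℕ} {S : Finset (Fin n)} {x : Fin n} (hx : x ∈ S) :
    rankIn S x < S.card :=
  card_lt_card ((Finset.ssubset_iff_of_subset (filter_subset _ _)).2 ⟨x, hx, by simp⟩)

theorem exists_rankIn_eq {n : ℕ} (S : Finset (Fin n)) {i : ℕ} (hi : i < S.card) :
    ∃ x ∈ S, rankIn S x = i := by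
  have h : S.image (rankIn S) = range S.card := by
    refine eq_of_subset_of_card_le (fun i hi => ?_) ?_
    · obtain ⟨x, hx, rfl⟩ := mem_image.1 hi
      exact mem_range.2 (rankIn_lt_card hx)
    · rw [card_image_of_injOn (rankIn_injOn S), card_range]
  have := mem_range.2 hi
  rw [← h, mem_image] at this
  exact this

theorem rankIn_image {n : ℕ} {p : Equiv.Perm (Fin n)} {S : Finset (Fin n)}
    (hp : StrictMonoOn p (S : Set (Fin n))) {x : Fin n} (hx : x ∈ S) :
    rankIn (S.image p) (p x) = rankIn S x := by
  have h : (S.image p).filter (· < p x) = (S.filter (· < x)).image p := by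
    ext z
    simp only [mem_filter, mem_image]
    constructor
    · rintro ⟨⟨y, hy, rfl⟩, hlt⟩
      exact ⟨y, ⟨hy, (hp.lt_iff_lt hy hx).1 hlt⟩, rfl⟩
    · rintro ⟨y, ⟨hy, hlt⟩, rfl⟩
      exact ⟨⟨y, hy, rfl⟩, hp hy hx hlt⟩
  rw [rankIn, h, card_image_of_injective _ p.injective, rankIn]

theorem eqOn_of_image_eq {n : ℕ} {p q : Equiv.Perm (Fin n)} {S : Finset (Fin n)}
    (hp : StrictMonoOn p (S : Set (Fin n))) (hq : StrictMonoOn q (S : Set (Fin n)))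
    (h : S.image p = S.image q) {x : Fin n} (hx : x ∈ S) : p x = q x := by
  refine rankIn_injOn (S.image p) (mem_image_of_mem p hx) (h ▸ mem_image_of_mem q hx) ?_
  rw [rankIn_image hp hx, h, rankIn_image hq hx]

theorem image_compl_perm {n : ℕ} (p : Equiv.Perm (Fin n)) (S : Finset (Fin n)) :
    Sᶜ.image p = (S.image p)ᶜ := by
  apply coe_injective
  push_cast
  exact Set.image_compl_eq p.bijective

/-- A permutation that is increasing on `S` and on its complement is determined by `S` and the
image of `S`. -/
theorem perm_eq_of_image_eq {n : ℕ} {p q : Equiv.Perm (Fin n)} {S : Finset (Fin n)}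
    (hp : StrictMonoOn p (S : Set (Fin n))) (hp' : StrictMonoOn p ((Sᶜ : Finset (Fin n)) : Set (Fin n)))
    (hq : StrictMonoOn q (S : Set (Fin n))) (hq' : StrictMonoOn q ((Sᶜ : Finset (Fin n)) : Set (Fin n)))
    (h : S.image p = S.image q) : p = q := by
  ext1 x
  by_cases hx : x ∈ S
  · exact eqOn_of_image_eq hp hq h hx
  · exact eqOn_of_image_eq hp' hq' (by rw [image_compl_perm, image_compl_perm, h])
      (mem_compl.2 hx)

theorem exists_perm_strictMonoOn {n : ℕ} {P V : Finset (Fin n)} (h : P.card = V.card) :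
    ∃ p : Equiv.Perm (Fin n), StrictMonoOn p (P : Set (Fin n)) ∧
      StrictMonoOn p ((Pᶜ : Finset (Fin n)) : Set (Fin n)) ∧ P.image p = V := by
  have h' : Pᶜ.card = Vᶜ.card := by rw [card_compl, card_compl, h]
  let e : P ≃o V := (P.orderIsoOfFin rfl).symm.trans (V.orderIsoOfFin h.symm)
  let e' : (Pᶜ : Finset (Fin n)) ≃o (Vᶜ : Finset (Fin n)) :=
    (Pᶜ.orderIsoOfFin rfl).symm.trans (Vᶜ.orderIsoOfFin h'.symm)
  let g : Fin n → Fin n := fun x =>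
    if hx : x ∈ P then (e ⟨x, hx⟩ : Fin n) else e' ⟨x, mem_compl.2 hx⟩
  have g1 : ∀ x (hx : x ∈ P), g x = e ⟨x, hx⟩ := fun x hx => dif_pos hx
  have g2 : ∀ x (hx : x ∈ Pᶜ), g x = e' ⟨x, hx⟩ := fun x hx => dif_neg (mem_compl.1 hx)
  have m1 : ∀ x ∈ P, g x ∈ V := fun x hx => by rw [g1 x hx]; exact (e _).2
  have m2 : ∀ x ∈ Pᶜ, g x ∈ Vᶜ := fun x hx => by rw [g2 x hx]; exact (e' _).2
  have s1 : StrictMonoOn g (P : Set (Fin n)) := fun x hx y hy hxy => by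
    rw [g1 x hx, g1 y hy]
    exact e.strictMono (show (⟨x, hx⟩ : P) < ⟨y, hy⟩ from hxy)
  have s2 : StrictMonoOn g ((Pᶜ : Finset (Fin n)) : Set (Fin n)) := fun x hx y hy hxy => by
    rw [g2 x hx, g2 y hy]
    exact e'.strictMono (show (⟨x, hx⟩ : (Pᶜ : Finset (Fin n))) < ⟨y, hy⟩ from hxy)
  have hg : Function.Injective g := by
    intro x y hxy
    by_cases hx : x ∈ P <;> by_cases hy : y ∈ P
    · exact s1.injOn hx hy hxy
    · exact absurd (hxy ▸ m1 x hx) (mem_compl.1 (m2 y (mem_compl.2 hy)))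
    · exact absurd (hxy.symm ▸ m1 y hy) (mem_compl.1 (m2 x (mem_compl.2 hx)))
    · exact s2.injOn (mem_compl.2 hx) (mem_compl.2 hy) hxy
  refine ⟨Equiv.ofBijective g (Finite.injective_iff_bijective.1 hg), s1, s2, ?_⟩
  refine eq_of_subset_of_card_le (fun y hy => ?_) ?_
  · obtain ⟨x, hx, rfl⟩ := mem_image.1 hy
    exact m1 x hx
  · rw [card_image_of_injective _ (Equiv.injective _), h]

/-! ### 321-avoidance and the upper bound -/

/-- Of three positions, two lie in the same part, so they are not inverted. -/
theorem avoids_pattern321_of_strictMonoOn {n : ℕ} {p : Equiv.Perm (Fin n)} {P : Finset (Fin n)}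
    (h1 : StrictMonoOn p (P : Set (Fin n)))
    (h2 : StrictMonoOn p ((Pᶜ : Finset (Fin n)) : Set (Fin n))) :
    AvoidsPattern p pattern321 := by
  rintro ⟨f, hf, h⟩
  have key : ∀ r s : Fin 3, r < s → ¬ (f r ∈ P ↔ f s ∈ P) := by
    intro r s hrs hiff
    have hlt : p (f s) < p (f r) := (h s r).2 (by simpa [pattern321] using hrs)
    by_cases hr : f r ∈ P
    · exact (h1 hr (hiff.1 hr) (hf hrs)).asymm hlt
    · exact (h2 (mem_compl.2 hr) (mem_compl.2 fun hs => hr (hiff.2 hs)) (hf hrs)).asymm hlt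
  have a := key 0 1 (by decide)
  have b := key 1 2 (by decide)
  have c := key 0 2 (by decide)
  tauto

theorem exists_strictMonoOn_of_avoids {n : ℕ} {p : Equiv.Perm (Fin n)}
    (hp : AvoidsPattern p pattern321) :
    ∃ P : Finset (Fin n), StrictMonoOn p (P : Set (Fin n)) ∧
      StrictMonoOn p ((Pᶜ : Finset (Fin n)) : Set (Fin n)) := by
  classical
  -- Take the left-to-right maxima. An inversion among the other entries, preceded by a larger
  -- entry, would be a 321.
  refine ⟨univ.filter fun x => ∀ y < x, p y < p x, ?_, ?_⟩
  · intro x _ y hy hxy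
    exact (mem_filter.1 (mem_coe.1 hy)).2 x hxy
  · intro x hx y _ hxy
    by_contra hle
    have hyx : p y < p x := lt_of_le_of_ne (not_lt.1 hle) (p.injective.ne hxy.ne')
    simp only [coe_compl, coe_filter, mem_univ, true_and, Set.mem_compl_iff, Set.mem_ofPred_eq,
      not_forall, not_lt] at hx
    obtain ⟨z, hzx, hxz⟩ := hx
    have hxz : p x < p z := lt_of_le_of_ne hxz (p.injective.ne hzx.ne')
    have hyz := hyx.trans hxz
    refine hp ⟨![z, x, y], ?_, ?_⟩
    · intro r s hrs
      fin_cases r <;> fin_cases s <;> simp_all [hzx.trans hxy]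
    · intro r s
      fin_cases r <;> fin_cases s <;>
        simp [pattern321, hxz, hyx, hyz, hxz.le, hyx.le, hyz.le]

theorem ulisCount_le_four_pow (n : ℕ) : ulisCount pattern321 n ≤ 4 ^ n := by
  classical
  choose P hP hP' using fun p : {p : Equiv.Perm (Fin n) // AvoidsPattern p pattern321 ∧ HasULIS p} =>
    exists_strictMonoOn_of_avoids p.2.1
  have hinj : Function.Injective fun p => (P p, (P p).image p.1) := by
    intro p q hpq
    obtain ⟨h1, h2⟩ := Prod.mk.inj hpq
    apply Subtype.ext
    have hq := hP q
    have hq' := hP' q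
    rw [← h1] at hq hq' h2
    exact perm_eq_of_image_eq (hP p) (hP' p) hq hq' h2
  have := Nat.card_le_card_of_injective _ hinj
  rw [Nat.card_prod, Nat.card_eq_fintype_card (α := Finset (Fin n)), Fintype.card_finset,
    Fintype.card_fin, ← mul_pow] at this
  exact this

/-! ### A criterion for a unique longest increasing subsequence -/

/-- If `x ∉ P` has rank `a` in `Pᶜ`, the elements of `P` of ranks `a + c` and `a + c + 1` precede
`x` by `hP` and have larger values by `hV`. So `t` omits both whenever it contains `x`. -/
theorem card_lt_of_conflicts {n : ℕ} {p : Equiv.Perm (Fin n)} {P : Finset (Fin n)} {c : ℕ}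
    (h1 : StrictMonoOn p (P : Set (Fin n)))
    (h2 : StrictMonoOn p ((Pᶜ : Finset (Fin n)) : Set (Fin n)))
    (hP : ∀ x ∈ Pᶜ, rankIn Pᶜ x + c + 2 ≤ rankIn P x)
    (hV : ∀ y ∈ (P.image p)ᶜ, rankIn (P.image p) y ≤ rankIn (P.image p)ᶜ y + c)
    {t : Finset (Fin n)} (ht : IsIncreasingSubseq p t) (hne : t ≠ P) : t.card < P.card := by
  have hcard : ∀ x, rankIn P x ≤ P.card := fun x => card_filter_le _ _
  rcases (t \ P).eq_empty_or_nonempty with hL | hL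
  · exact card_lt_card ((sdiff_eq_empty_iff_subset.1 hL).ssubset_of_ne hne)
  have conflict : ∀ x ∈ t \ P, ∀ i, rankIn Pᶜ x + c ≤ i → i < rankIn Pᶜ x + c + 2 →
      i ∈ (P \ t).image (rankIn P) := by
    intro x hx i hi hi'
    obtain ⟨hxt, hxP⟩ := mem_sdiff.1 hx
    have hxc := mem_compl.2 hxP
    have hb := hP x hxc
    obtain ⟨u, hu, rfl⟩ := exists_rankIn_eq P (i := i) (by have := hcard x; omega)
    refine mem_image_of_mem _ (mem_sdiff.2 ⟨hu, fun hut => ?_⟩)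
    have hux : u < x := by
      by_contra hle
      have := rankIn_mono P (not_lt.1 hle)
      omega
    have hlt := ht hut hxt hux
    have h3 := rankIn_lt_rankIn (mem_image_of_mem p hu) hlt
    rw [rankIn_image h1 hu] at h3
    have h4 := hV (p x) (by rw [← image_compl_perm]; exact mem_image_of_mem p hxc)
    rw [← image_compl_perm, rankIn_image h2 hxc] at h4
    omega
  have hinj : Set.InjOn (fun x => rankIn Pᶜ x + c) (t \ P : Finset (Fin n)) := by
    intro x hx y hy hxy
    exact rankIn_injOn Pᶜ (mem_coe.2 (mem_compl.2 (mem_sdiff.1 hx).2))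
      (mem_coe.2 (mem_compl.2 (mem_sdiff.1 hy).2)) (Nat.add_right_cancel hxy)
  have hlt : (t \ P).card < (P \ t).card := by
    obtain ⟨x, hx, hmax⟩ := exists_max_image _ (rankIn Pᶜ) hL
    rw [← card_image_of_injOn hinj,
      ← card_image_of_injOn ((rankIn_injOn P).mono (coe_subset.2 (sdiff_subset (t := t))))]
    refine card_lt_card ((Finset.ssubset_iff_of_subset fun i hi => ?_).2
      -- The second conflict of the highest-ranked `x` is one more omission, which makes the
      -- inequality strict.
      ⟨rankIn Pᶜ x + c + 1, conflict x hx _ (by omega) (by omega), fun hi => ?_⟩)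
    · obtain ⟨y, hy, rfl⟩ := mem_image.1 hi
      exact conflict y hy _ (by omega) (by omega)
    · obtain ⟨y, hy, hyx⟩ := mem_image.1 hi
      have := hmax y hy
      omega
  exact card_sdiff_lt_card_sdiff_iff.1 hlt

/-! ### Balanced block sets and their ranks -/

theorem card_filter_fin {n : ℕ} (Q : ℕ → Prop) [DecidablePred Q] :
    (univ.filter fun i : Fin n => Q i).card = Nat.count Q n := by
  rw [Nat.count_eq_card_filter_range]
  refine card_bij (fun i _ => (i : ℕ)) ?_ (fun i _ j _ h => Fin.ext h) ?_
  · intro i hi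
    exact mem_filter.2 ⟨mem_range.2 i.2, (mem_filter.1 hi).2⟩
  · intro i hi
    obtain ⟨hin, hi⟩ := mem_filter.1 hi
    exact ⟨⟨i, mem_range.1 hin⟩, mem_filter.2 ⟨mem_univ _, hi⟩, rfl⟩

theorem rankIn_filter {n : ℕ} (Q : ℕ → Prop) [DecidablePred Q] (x : Fin n) :
    rankIn (univ.filter fun i : Fin n => Q i) x = Nat.count Q x := by
  rw [rankIn, Nat.count_eq_card_filter_range]
  refine card_bij (fun i _ => (i : ℕ)) ?_ (fun i _ j _ h => Fin.ext h) ?_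
  · intro i hi
    obtain ⟨hi, hix⟩ := mem_filter.1 hi
    exact mem_filter.2 ⟨mem_range.2 hix, (mem_filter.1 hi).2⟩
  · intro i hi
    obtain ⟨hix, hi⟩ := mem_filter.1 hi
    have hix := mem_range.1 hix
    exact ⟨⟨i, hix.trans x.2⟩,
      mem_filter.2 ⟨mem_filter.2 ⟨mem_univ _, hi⟩, hix⟩, rfl⟩

theorem rankIn_add_rankIn_compl {n : ℕ} (S : Finset (Fin n)) (x : Fin n) :
    rankIn S x + rankIn Sᶜ x = x := by
  rw [rankIn, rankIn, ← card_union_of_disjoint, ← filter_union, union_compl]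
  · rw [filter_gt_eq_Iio, Fin.card_Iio]
  · exact disjoint_filter_filter disjoint_compl_right

/-- Sequences of `K` subsets of size `m` of `{0, …, 2 m - 1}`. -/
abbrev BlockSeq (K m : ℕ) : Type :=
  Fin K → {s : Finset ℕ // s ∈ powersetCard m (range (2 * m))}

/-- The subset of `{0, …, 2 m K - 1}` whose trace on the `k`-th block of length `2 m` is `f k`. -/
def InBlocks {K m : ℕ} (f : BlockSeq K m) (i : ℕ) : Prop :=
  ∃ h : i / (2 * m) < K, i % (2 * m) ∈ (f ⟨i / (2 * m), h⟩).1

theorem inBlocks_mul_add {K m : ℕ} (f : BlockSeq K m) (k : Fin K) {i : ℕ} (hi : i < 2 * m) :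
    InBlocks f (2 * m * k + i) ↔ i ∈ (f k).1 := by
  have h1 : (2 * m * k + i) / (2 * m) = k := by
    rw [Nat.mul_add_div (by omega), Nat.div_eq_of_lt hi, add_zero]
  have h2 : (2 * m * k + i) % (2 * m) = i := by
    rw [Nat.mul_add_mod, Nat.mod_eq_of_lt hi]
  simp [InBlocks, h1, h2]

theorem inBlocks_injective {K m : ℕ} {f g : BlockSeq K m}
    (h : ∀ i < 2 * m * K, InBlocks f i ↔ InBlocks g i) : f = g := by
  funext k
  apply Subtype.ext
  have hf := (mem_powersetCard.1 (f k).2).1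
  have hg := (mem_powersetCard.1 (g k).2).1
  have key : ∀ i < 2 * m, i ∈ (f k).1 ↔ i ∈ (g k).1 := by
    intro i hi
    rw [← inBlocks_mul_add f k hi, ← inBlocks_mul_add g k hi]
    apply h
    calc 2 * m * k + i < 2 * m * (k + 1) := by rw [mul_add]; omega
      _ ≤ 2 * m * K := Nat.mul_le_mul_left _ k.2
  ext i
  exact ⟨fun hi => (key i (mem_range.1 (hf hi))).1 hi, fun hi => (key i (mem_range.1 (hg hi))).2 hi⟩

open Classical in
theorem count_inBlocks_mul {K m : ℕ} (f : BlockSeq K m) {q : ℕ} (hq : q ≤ K) :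
    Nat.count (InBlocks f) (2 * m * q) = m * q := by
  induction q with
  | zero => simp
  | succ q ih =>
    rw [mul_add, mul_one, Nat.count_add, ih (by omega), mul_add, mul_one,
      Nat.count_eq_card_filter_range]
    congr 1
    obtain ⟨hsub, hcard⟩ := mem_powersetCard.1 (f ⟨q, hq⟩).2
    refine (congrArg card ?_).trans hcard
    ext i
    simp only [mem_filter, mem_range]
    constructor
    · rintro ⟨hi, h⟩
      exact (inBlocks_mul_add f ⟨q, hq⟩ hi).1 h
    · intro h
      have hi := mem_range.1 (hsub h)
      exact ⟨hi, (inBlocks_mul_add f ⟨q, hq⟩ hi).2 h⟩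

open Classical in
-- The density is exactly one half at block ends, so the drift is bounded by one block length.
theorem count_inBlocks_bounds {K m : ℕ} (hm : 0 < m) (f : BlockSeq K m) {y : ℕ}
    (hy : y ≤ 2 * m * K) :
    2 * Nat.count (InBlocks f) y ≤ y + 2 * m ∧ y ≤ 2 * Nat.count (InBlocks f) y + 2 * m := by
  rcases hy.eq_or_lt with rfl | hy
  · rw [count_inBlocks_mul f le_rfl]
    constructor <;> nlinarith
  · have hq : y / (2 * m) < K := Nat.div_lt_of_lt_mul hy
    set q := y / (2 * m)
    have h1 : 2 * m * q ≤ y := Nat.mul_div_le y (2 * m)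
    have h2 : y < 2 * m * (q + 1) := Nat.lt_mul_div_succ y (by omega)
    have c1 := Nat.count_monotone (InBlocks f) h1
    have c2 := Nat.count_monotone (InBlocks f) h2.le
    rw [count_inBlocks_mul f hq.le] at c1
    rw [count_inBlocks_mul f hq] at c2
    constructor <;> nlinarith

open Classical in
theorem count_lt_or_sub {Q : ℕ → Prop} (s k : ℕ) :
    Nat.count (fun i => i < s ∨ Q (i - s)) (s + k) = s + Nat.count Q k := by
  rw [Nat.count_add]
  congr 1
  · exact Nat.count_of_forall fun i hi => Or.inl hi
  · congr 1
    simp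

open Classical in
theorem count_le_or_of_le {Q : ℕ → Prop} {N y : ℕ} (hy : y ≤ N) :
    Nat.count (fun i => N ≤ i ∨ Q i) y = Nat.count Q y := by
  rw [Nat.count_eq_card_filter_range, Nat.count_eq_card_filter_range]
  congr 1
  refine filter_congr fun i hi => or_iff_right ?_
  have := mem_range.1 hi
  omega

open Classical in
theorem count_le_or_add {Q : ℕ → Prop} (N k : ℕ) :
    Nat.count (fun i => N ≤ i ∨ Q i) (N + k) = Nat.count Q N + k := by
  rw [Nat.count_add, count_le_or_of_le le_rfl]
  congr 1
  exact Nat.count_of_forall fun i _ => Or.inl (Nat.le_add_right N i)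

open Classical in
/-- Every position before `s` together with the block set of `f` shifted by `s`. -/
noncomputable def shiftedBlocks {K m : ℕ} (s : ℕ) (f : BlockSeq K m) :
    Finset (Fin (s + 2 * m * K)) :=
  univ.filter fun i => (i : ℕ) < s ∨ InBlocks f (i - s)

open Classical in
/-- The block set of `f` together with the last `s` elements. -/
noncomputable def extendedBlocks {K m : ℕ} (s : ℕ) (f : BlockSeq K m) :
    Finset (Fin (s + 2 * m * K)) :=
  univ.filter fun i => 2 * m * K ≤ (i : ℕ) ∨ InBlocks f i

theorem mem_shiftedBlocks {K m s : ℕ} {f : BlockSeq K m} {i : Fin (s + 2 * m * K)} :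
    i ∈ shiftedBlocks s f ↔ (i : ℕ) < s ∨ InBlocks f (i - s) := by
  simp [shiftedBlocks]

theorem mem_extendedBlocks {K m s : ℕ} {f : BlockSeq K m} {i : Fin (s + 2 * m * K)} :
    i ∈ extendedBlocks s f ↔ 2 * m * K ≤ (i : ℕ) ∨ InBlocks f i := by
  simp [extendedBlocks]

theorem card_shiftedBlocks_eq {K m s : ℕ} (f g : BlockSeq K m) :
    (shiftedBlocks s f).card = (extendedBlocks s g).card := by
  classical
  rw [shiftedBlocks, extendedBlocks, card_filter_fin (fun i => i < s ∨ InBlocks f (i - s)),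
    card_filter_fin (fun i => 2 * m * K ≤ i ∨ InBlocks g i), count_lt_or_sub,
    add_comm s (2 * m * K), count_le_or_add, count_inBlocks_mul f le_rfl,
    count_inBlocks_mul g le_rfl, add_comm]

theorem rankIn_shiftedBlocks {K m s : ℕ} (hm : 0 < m) (f : BlockSeq K m)
    {x : Fin (s + 2 * m * K)} (hx : x ∈ (shiftedBlocks s f)ᶜ) :
    rankIn (shiftedBlocks s f)ᶜ x + s ≤ rankIn (shiftedBlocks s f) x + 2 * m := by
  classical
  have hadd := rankIn_add_rankIn_compl (shiftedBlocks s f) x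
  have hr : rankIn (shiftedBlocks s f) x = _ :=
    rankIn_filter (fun i => i < s ∨ InBlocks f (i - s)) x
  have hxs : s ≤ x := by
    by_contra hlt
    exact mem_compl.1 hx (mem_shiftedBlocks.2 (Or.inl (not_le.1 hlt)))
  obtain ⟨k, hk⟩ := Nat.exists_eq_add_of_le hxs
  have hb := count_inBlocks_bounds hm f (y := k) (by have := x.2; omega)
  rw [hk, count_lt_or_sub] at hr
  omega

theorem rankIn_extendedBlocks {K m s : ℕ} (hm : 0 < m) (f : BlockSeq K m)
    {y : Fin (s + 2 * m * K)} (hy : y ∈ (extendedBlocks s f)ᶜ) :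
    rankIn (extendedBlocks s f) y ≤ rankIn (extendedBlocks s f)ᶜ y + 2 * m := by
  classical
  have hadd := rankIn_add_rankIn_compl (extendedBlocks s f) y
  have hr : rankIn (extendedBlocks s f) y = _ :=
    rankIn_filter (fun i => 2 * m * K ≤ i ∨ InBlocks f i) y
  have hyN : (y : ℕ) ≤ 2 * m * K := by
    by_contra hlt
    exact mem_compl.1 hy (mem_extendedBlocks.2 (Or.inl (not_le.1 hlt).le))
  have hb := count_inBlocks_bounds hm f hyN
  rw [count_le_or_of_le hyN] at hr
  omega

/-! ### Many permutations from pairs of block sequences -/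

theorem exists_perm_of_blockSeq {K m s : ℕ} (hm : 0 < m) (hs : 4 * m + 2 ≤ s)
    (f g : BlockSeq K m) :
    ∃ p : Equiv.Perm (Fin (s + 2 * m * K)), AvoidsPattern p pattern321 ∧
      IsIncreasingSubseq p (shiftedBlocks s f) ∧
      (∀ t, IsIncreasingSubseq p t → t ≠ shiftedBlocks s f → t.card < (shiftedBlocks s f).card) ∧
      (shiftedBlocks s f).image p = extendedBlocks s g := by
  obtain ⟨p, h1, h2, h3⟩ := exists_perm_strictMonoOn (card_shiftedBlocks_eq (s := s) f g)
  refine ⟨p, avoids_pattern321_of_strictMonoOn h1 h2, h1, fun t ht hne => ?_, h3⟩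
  -- The drift in values costs `2m`, the drift in positions another `2m`, and two conflicts are
  -- needed: hence `s ≥ 4m + 2`.
  refine card_lt_of_conflicts (c := 2 * m) h1 h2 (fun x hx => ?_) (fun y hy => ?_) ht hne
  · have := rankIn_shiftedBlocks hm f hx
    omega
  · rw [h3] at hy ⊢
    exact rankIn_extendedBlocks hm g hy

theorem centralBinom_pow_le_ulisCount {K m s : ℕ} (hm : 0 < m) (hs : 4 * m + 2 ≤ s) :
    Nat.centralBinom m ^ (2 * K) ≤ ulisCount pattern321 (s + 2 * m * K) := by
  choose p hav hinc hmax himg using fun fg : BlockSeq K m × BlockSeq K m =>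
    exists_perm_of_blockSeq hm hs fg.1 fg.2
  have hinj : Function.Injective fun fg =>
      (⟨p fg, hav fg, _, hinc fg, hmax fg⟩ :
        {p : Equiv.Perm (Fin (s + 2 * m * K)) // AvoidsPattern p pattern321 ∧ HasULIS p}) := by
    intro a b hab
    have hp : p a = p b := congrArg Subtype.val hab
    -- The position set is recovered from the permutation as its unique longest increasing
    -- subsequence.
    have hP : shiftedBlocks s a.1 = shiftedBlocks s b.1 := by
      by_contra hne
      exact (hmax a _ (hp ▸ hinc b) (Ne.symm hne)).asymm (hmax b _ (hp ▸ hinc a) hne)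
    have hV := himg a
    rw [hP, hp, himg b] at hV
    refine Prod.ext (inBlocks_injective fun i hi => ?_) (inBlocks_injective fun i hi => ?_)
    · simpa [mem_shiftedBlocks] using Finset.ext_iff.1 hP ⟨s + i, by omega⟩
    · simpa [mem_extendedBlocks, hi.not_ge] using (Finset.ext_iff.1 hV ⟨i, by omega⟩).symm
  have := Nat.card_le_card_of_injective _ hinj
  rwa [Nat.card_prod, Nat.card_fun, Nat.card_eq_fintype_card, Nat.card_eq_fintype_card,
    Fintype.card_coe, card_powersetCard, card_range, Fintype.card_fin, ← pow_add, ← two_mul,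
    ← Nat.centralBinom_eq_two_mul_choose] at this

/-! ### Passage to the limit -/

theorem centralBinom_rpow_le_ulisCount {m n : ℕ} (hm : 0 < m) (hn : 4 * m + 2 ≤ n) :
    (Nat.centralBinom m : ℝ) ^ ((n : ℝ) / m - 8) ≤ ulisCount pattern321 n := by
  set K := (n - (4 * m + 2)) / (2 * m) with hK
  have h1 : 2 * m * K ≤ n - (4 * m + 2) := Nat.mul_div_le _ _
  have h2 : n - (4 * m + 2) < 2 * m * (K + 1) := Nat.lt_mul_div_succ _ (by omega)
  have hle := centralBinom_pow_le_ulisCount (K := K) hm (s := n - 2 * m * K) (by omega)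
  rw [Nat.sub_add_cancel (by omega)] at hle
  have hm' : (0 : ℝ) < m := Nat.cast_pos.2 hm
  -- The padding costs `4 + 2/m ≤ 6` in the exponent and rounding down `K` costs at most `2`.
  have hexp : (n : ℝ) / m - 8 ≤ ((2 * K : ℕ) : ℝ) := by
    rw [sub_le_iff_le_add, div_le_iff₀ hm']
    have : n ≤ (2 * K + 8) * m := by nlinarith [Nat.sub_add_cancel hn]
    exact_mod_cast this
  calc (Nat.centralBinom m : ℝ) ^ ((n : ℝ) / m - 8)
      ≤ (Nat.centralBinom m : ℝ) ^ ((2 * K : ℕ) : ℝ) :=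
        Real.rpow_le_rpow_of_exponent_le (Nat.one_le_cast.2 (Nat.centralBinom_pos m)) hexp
    _ ≤ ulisCount pattern321 n := by
        rw [Real.rpow_natCast]
        exact_mod_cast hle

theorem tendsto_centralBinom_rpow {m : ℕ} :
    Tendsto (fun n : ℕ => ((Nat.centralBinom m : ℝ) ^ ((n : ℝ) / m - 8)) ^ (1 / (n : ℝ)))
      atTop (𝓝 ((Nat.centralBinom m : ℝ) ^ (1 / (m : ℝ)))) := by
  have hpos : (0 : ℝ) < Nat.centralBinom m := Nat.cast_pos.2 (Nat.centralBinom_pos m)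
  have hlim : Tendsto (fun n : ℕ => 1 / (m : ℝ) - 8 * (1 / (n : ℝ))) atTop (𝓝 (1 / (m : ℝ))) := by
    simpa using (tendsto_const_nhds (x := 1 / (m : ℝ))).sub
      ((tendsto_one_div_atTop_nhds_zero_nat (𝕜 := ℝ)).const_mul 8)
  refine (tendsto_const_nhds.rpow hlim (Or.inl hpos.ne')).congr' ?_
  filter_upwards [eventually_gt_atTop 0] with n hn
  have hn' : (n : ℝ) ≠ 0 := Nat.cast_ne_zero.2 hn.ne'
  rw [← Real.rpow_mul hpos.le]
  congr 1
  field_simp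

/-- The `m`-th root of `4 ^ m ≤ 2m * centralBinom m`, written through `(2m) ^ (1 / (2m))`, which
tends to `1`. -/
theorem four_div_le_centralBinom_rpow {m : ℕ} (hm : 0 < m) :
    4 / (((2 * m : ℕ) : ℝ) ^ (1 / ((2 * m : ℕ) : ℝ))) ^ 2 ≤
      (Nat.centralBinom m : ℝ) ^ (1 / (m : ℝ)) := by
  have hm' : (0 : ℝ) < m := Nat.cast_pos.2 hm
  have h2m : (0 : ℝ) < ((2 * m : ℕ) : ℝ) := Nat.cast_pos.2 (by omega)
  have h : (4 : ℝ) ^ m / ((2 * m : ℕ) : ℝ) ≤ Nat.centralBinom m := by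
    rw [div_le_iff₀ h2m, mul_comm]
    exact_mod_cast Nat.four_pow_le_two_mul_self_mul_centralBinom m hm
  refine le_trans (le_of_eq ?_) (Real.rpow_le_rpow (by positivity) h (by positivity))
  rw [Real.div_rpow (by positivity) h2m.le, one_div (m : ℝ),
    Real.pow_rpow_inv_natCast (by norm_num) hm.ne', ← Real.rpow_natCast, ← Real.rpow_mul h2m.le]
  congr 2
  push_cast
  field_simp

theorem tendsto_four_div :
    Tendsto (fun m : ℕ => 4 / (((2 * m : ℕ) : ℝ) ^ (1 / ((2 * m : ℕ) : ℝ))) ^ 2)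
      atTop (𝓝 4) := by
  have h2 : Tendsto (fun m : ℕ => ((2 * m : ℕ) : ℝ)) atTop atTop :=
    tendsto_natCast_atTop_atTop.comp (tendsto_id.const_mul_atTop' (by norm_num))
  simpa [Pi.div_def] using (tendsto_const_nhds (x := (4 : ℝ))).div ((tendsto_rpow_div.comp h2).pow 2)
    (by norm_num)

theorem mainTheorem1 :
    Filter.Tendsto (fun n : ℕ => (ulisCount pattern321 n : ℝ) ^ (1 / (n : ℝ)))
      Filter.atTop (nhds 4) := by
  refine tendsto_order.2 ⟨fun a ha => ?_, fun b hb => ?_⟩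
  · obtain ⟨m, ham, hm⟩ :=
      ((tendsto_four_div.eventually_const_lt ha).and (eventually_gt_atTop 0)).exists
    have ham := ham.trans_le (four_div_le_centralBinom_rpow hm)
    filter_upwards [tendsto_centralBinom_rpow.eventually_const_lt ham,
      eventually_ge_atTop (4 * m + 2)] with n han hn
    exact han.trans_le (Real.rpow_le_rpow (by positivity) (centralBinom_rpow_le_ulisCount hm hn)
      (by positivity))
  · filter_upwards [eventually_gt_atTop 0] with n hn
    refine lt_of_le_of_lt ?_ hb
    have h : (ulisCount pattern321 n : ℝ) ≤ 4 ^ n := by exact_mod_cast ulisCount_le_four_pow n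
    refine (Real.rpow_le_rpow (by positivity) h (by positivity)).trans (le_of_eq ?_)
    rw [one_div, Real.pow_rpow_inv_natCast (by norm_num) hn.ne']
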